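/- Let $M\ge 1$ receivers and $N\ge 1$ transmitters be connected by a channel matrix $\mathbf H=(h_{ij})\in\mathbb R_{+}^{M\times N}$ with independent log-normal entries, $\ln h_{ij}\sim\mathcal N(\mu_{ij},\sigma_{ij}^2)$, $\sigma_{ij}>0$, and let $\mathbf h_i^T$ be its $i$-th row. A space code is given by a finite constellation $\mathcal B\subset\mathbb R$ and encoders $\mathbf F_\ell:\mathcal B\to\mathbb R^N$, $\ell=1,\dots,L$; its codewords are $\mathbf x(\mathbf s)=\sum_{\ell=1}^L\mathbf F_\ell(s_\ell)$, $\mathbf s\in\mathcal B^L$. Assume that its average optical power $P_{op}=|\mathcal B|^{-L}\sum_{\mathbf s\in\mathcal B^L}\sum_{n=1}^N x_n(\mathbf s)$ is positive (this is automatic if all codewords have nonnegative entries and at least two codewords are distinct). Let $\mathcal E$ be the set of all nonzero differences of two codewords. For $\mathbf e\in\mathcal E$ and squared optical signal-to-noise ratio $\rho>0$, the pairwise error probability of the maximum likelihood receiver is $$P_{\mathbf e}(\rho)=\mathbb E_{\mathbf H}\!\left[Q\!\left(\frac{d(\mathbf e)}{2}\right)\right],\qquad d^2(\mathbf e)=\frac{\rho}{N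 P_{op}^2}\sum_{i=1}^M\left(\mathbf h_i^T\mathbf e\right)^2,\qquad Q(x)=\frac1{\sqrt{2\pi}}\int_x^\infty e^{-t^2/2}\,dt .$$ Say that $P_{\mathbf e}$ has large-scale diversity gain $D$ if $$\ln P_{\mathbf e}(\rho)=-\left(\frac{D}{8}+o(1)\right)\ln^2\frac{\rho}{\ln^2\rho}\qquad(\rho\to\infty),$$ and that the code enables full large-scale diversity if $P_{\mathbf e}$ has large-scale diversity gain $\Omega=\sum_{i=1}^M\sum_{j=1}^N\sigma_{ij}^{-2}$ for every $\mathbf e\in\mathcal E$. Theorem. The space code enables full large-scale diversity if and only if every $\mathbf e\in\mathcal E$ is unipolar (its entries do not include two of opposite signs) and has no zero entry; equivalently, if and only if for every $\mathbf e\in\mathcal E$ all entries of the matrix $\mathbf e\mathbf e^T$ are positive. -/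

import Mathlib

namespace MimoOwc

/-- The Gaussian tail function `Q(x) = P(Z > x)`, where `Z` is a standard normal variable. -/
noncomputable def gaussianQ (x : ℝ) : ℝ :=
  (ProbabilityTheory.gaussianReal 0 1).real (Set.Ioi x)

/-- The log-normal law: the law of `exp z` where `z` is normal with mean `m` and variance `s ^ 2`. -/
noncomputable def logNormal (m s : ℝ) : MeasureTheory.Measure ℝ :=
  (ProbabilityTheory.gaussianReal m (Real.toNNReal (s ^ 2))).map Real.exp

/-- The law of the `M × N` channel matrix `(h i j)`: independent log-normal entries, where
`ln (h i j)` has mean `m i j` and variance `σ i j ^ 2`. Rows are receivers, columns transmitters. -/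
noncomputable def channelLaw {M N : ℕ} (m σ : Fin M → Fin N → ℝ) :
    MeasureTheory.Measure (Fin M → Fin N → ℝ) :=
  MeasureTheory.Measure.pi fun i => MeasureTheory.Measure.pi fun j => logNormal (m i j) (σ i j)

/-- A space code: a finite constellation, from which the `L` symbols are drawn, and for every
symbol an encoder mapping it to a vector indexed by the `N` transmitters. -/
structure SpaceCode (L N : ℕ) where
  constellation : Finset ℝ
  encoder : Fin L → ℝ → Fin N → ℝ

namespace SpaceCode

variable {L N : ℕ}

/-- The set of the symbol vectors that may be transmitted. -/
def symbols (C : SpaceCode L N) : Finset (Fin L → ℝ) :=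
  Fintype.piFinset fun _ => C.constellation

/-- The codeword of a symbol vector: the sum of the vectors encoding the single symbols. -/
def codeword (C : SpaceCode L N) (s : Fin L → ℝ) : Fin N → ℝ :=
  ∑ l, C.encoder l (s l)

/-- The average optical power: the mean of the sum of the entries of the codeword, for symbols
chosen independently and uniformly from the constellation. -/
noncomputable def opticalPower (C : SpaceCode L N) : ℝ :=
  (∑ s ∈ C.symbols, ∑ n, C.codeword s n) / (C.symbols.card : ℝ)

/-- The error set: the nonzero differences of two codewords. -/
def errorSet (C : SpaceCode L N) : Set (Fin N → ℝ) :=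
  {e | e ≠ 0 ∧ ∃ s ∈ C.symbols, ∃ t ∈ C.symbols, e = C.codeword s - C.codeword t}

end SpaceCode

/-- The received distance `d(e)`, given by `d(e)² = ρ / (N P²) * ∑ᵢ (hᵢᵀ e)²`, for the channel
matrix `h` with rows `hᵢ`, squared optical signal-to-noise ratio `ρ` and optical power `P`. -/
noncomputable def distance {M N : ℕ} (P ρ : ℝ) (e : Fin N → ℝ) (h : Fin M → Fin N → ℝ) : ℝ :=
  Real.sqrt (ρ / ((N : ℝ) * P ^ 2) * ∑ i, (h i ⬝ᵥ e) ^ 2)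

/-- The pairwise error probability of the maximum likelihood receiver for two codewords with
difference `e`: the conditional probability `Q(d(e)/2)` given the channel, averaged over the
channel. -/
noncomputable def pep {M N : ℕ} (m σ : Fin M → Fin N → ℝ) (P : ℝ) (e : Fin N → ℝ) (ρ : ℝ) : ℝ :=
  ∫ h, gaussianQ (distance P ρ e h / 2) ∂(channelLaw m σ)

/-- An error probability `p`, as a function of the squared optical signal-to-noise ratio `ρ`, has
large-scale diversity gain `D` if it decays like `exp (-(D / 8) * ln² (ρ / ln² ρ))` in the
exponent, that is, `ln (p ρ) = -(D / 8 + o(1)) * ln² (ρ / ln² ρ)` as `ρ → ∞`. -/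
def HasLargeScaleDiversityGain (p : ℝ → ℝ) (D : ℝ) : Prop :=
  Filter.Tendsto (fun ρ : ℝ => -8 * Real.log (p ρ) / Real.log (ρ / Real.log ρ ^ 2) ^ 2)
    Filter.atTop (nhds D)

/-- The full large-scale diversity gain `Ω = ∑ᵢⱼ σᵢⱼ⁻²`. -/
noncomputable def fullGain {M N : ℕ} (σ : Fin M → Fin N → ℝ) : ℝ :=
  ∑ i, ∑ j, (σ i j ^ 2)⁻¹

/-- A space code enables full large-scale diversity if all of its pairwise error probabilities
have the large-scale diversity gain `Ω`. -/
def EnablesFullLargeScaleDiversity {M N L : ℕ} (m σ : Fin M → Fin N → ℝ)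
    (C : SpaceCode L N) : Prop :=
  ∀ e ∈ C.errorSet, HasLargeScaleDiversityGain (pep m σ C.opticalPower e) (fullGain σ)

/-- A vector is unipolar if it does not have entries of opposite signs. -/
def IsUnipolar {N : ℕ} (e : Fin N → ℝ) : Prop :=
  (∀ j, 0 ≤ e j) ∨ (∀ j, e j ≤ 0)

end MimoOwc

namespace MimoOwc

open MeasureTheory ProbabilityTheory Filter Topology Set

/-! Put `ρ = exp x`, so exponents are measured against `x ^ 2`. An error is likely only if every `h
i ⬝ᵥ e` is of order `exp (-x / 2)`, so the question is what such channels cost. If `e` is unipolar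
without zero entries, positivity of the channel excludes cancellation: every `h i j` must itself be
that small. Each entry costs a normal tail at about `-x / 2`, that is `x ^ 2 / (8 σ²)`, and the
costs add up to `Ω` (`pep_le`). Otherwise some nonzero `p ≥ 0` is orthogonal to `e`
(`exists_nonneg_dotProduct_eq_zero`). Rows near `p` also cause errors, and the entries with `p j >
0` cost only `O(x)`, so the gain stays strictly below `Ω`. The same bound with `p = 0` gives the
other half of the full-gain case (`exists_exp_neg_le_pep`). -/

/-! ### Gaussian estimates -/

theorem gaussianReal_real_Iic_le (m : ℝ) {v : NNReal} (hv : v ≠ 0) {x : ℝ} (hx : x ≤ m) :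
    (gaussianReal m v).real (Iic x) ≤ Real.exp (-((m - x) ^ 2 / (2 * v))) := by
  have hv' : (0 : ℝ) < v := by positivity
  -- Chernoff bound; this `t` minimises the exponent.
  have h := measure_le_le_exp_mul_mgf (X := id) (μ := gaussianReal m v) x
    (t := (x - m) / v) (div_nonpos_of_nonpos_of_nonneg (by linarith) hv'.le)
    (integrable_exp_mul_gaussianReal _)
  rw [mgf_id_gaussianReal, ← Real.exp_add] at h
  refine h.trans_eq ?_
  congr 1
  field

theorem gaussianQ_le {x : ℝ} (hx : 0 ≤ x) : gaussianQ x ≤ Real.exp (-(x ^ 2 / 2)) := by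
  have h := measure_ge_le_exp_mul_mgf (X := id) (μ := gaussianReal 0 1) x
    (t := x) hx (integrable_exp_mul_gaussianReal _)
  rw [mgf_id_gaussianReal, ← Real.exp_add] at h
  refine (measureReal_mono fun y (hy : x < y) => hy.le).trans (h.trans_eq ?_)
  congr 1
  simp
  ring

/-- Length of the interval times the value of the density at distance `R` from the mean. -/
theorem le_gaussianReal_real_Ioc (m : ℝ) {v : NNReal} (hv : v ≠ 0) {a b R : ℝ} (hab : a ≤ b)
    (hR : ∀ t ∈ Ioc a b, |t - m| ≤ R) :
    (b - a) * ((√(2 * Real.pi * v))⁻¹ * Real.exp (-(R ^ 2 / (2 * v)))) ≤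
      (gaussianReal m v).real (Ioc a b) := by
  rw [Measure.real, gaussianReal_apply_eq_integral m hv, ENNReal.toReal_ofReal
    (integral_nonneg fun _ => gaussianPDFReal_nonneg _ _ _)]
  have h : ∫ _ in Ioc a b, ((√(2 * Real.pi * v))⁻¹ * Real.exp (-(R ^ 2 / (2 * v)))) ≤
      ∫ t in Ioc a b, gaussianPDFReal m v t := by
    refine setIntegral_mono_on (integrableOn_const (by simp))
      (integrable_gaussianPDFReal m v).integrableOn measurableSet_Ioc fun t ht => ?_
    have := sq_le_sq' (by linarith [hR t ht, neg_abs_le (t - m)])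
      ((le_abs_self _).trans (hR t ht))
    rw [gaussianPDFReal, neg_div]
    gcongr
  simpa [hab] using h

theorem gaussianQ_pos (x : ℝ) : 0 < gaussianQ x := by
  have h := le_gaussianReal_real_Ioc 0 one_ne_zero (a := x) (b := x + 1) (R := |x| + 1)
    (by linarith) fun t ht => by
      rw [sub_zero]
      exact abs_le.2 ⟨by linarith [ht.1, neg_abs_le x], by linarith [ht.2, le_abs_self x]⟩
  refine lt_of_lt_of_le ?_ (h.trans (measureReal_mono fun y hy => hy.1))
  rw [add_sub_cancel_left]
  simp only [NNReal.coe_one]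
  positivity

theorem gaussianQ_antitone : Antitone gaussianQ := fun _ _ h =>
  measureReal_mono (Ioi_subset_Ioi h)

theorem gaussianQ_le_one (x : ℝ) : gaussianQ x ≤ 1 := measureReal_le_one

/-! ### Log-normal probabilities of small sets -/

instance (m s : ℝ) : IsProbabilityMeasure (logNormal m s) :=
  Measure.isProbabilityMeasure_map Real.measurable_exp.aemeasurable

instance {M N : ℕ} (m σ : Fin M → Fin N → ℝ) : IsProbabilityMeasure (channelLaw m σ) := by
  unfold channelLaw
  infer_instance

theorem ae_logNormal_pos (m s : ℝ) : ∀ᵐ x ∂logNormal m s, 0 < x := by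
  rw [logNormal, ae_map_iff Real.measurable_exp.aemeasurable measurableSet_Ioi]
  exact ae_of_all _ Real.exp_pos

theorem logNormal_real_Iic (m s : ℝ) {t : ℝ} (ht : 0 < t) :
    (logNormal m s).real (Iic t) =
      (gaussianReal m (Real.toNNReal (s ^ 2))).real (Iic (Real.log t)) := by
  rw [logNormal, map_measureReal_apply Real.measurable_exp measurableSet_Iic]
  congr 1
  ext x
  simp [Real.le_log_iff_exp_le ht]

theorem tendsto_const_div_sq (c : ℝ) : Tendsto (fun x : ℝ => c / x ^ 2) atTop (𝓝 0) :=
  tendsto_const_nhds.div_atTop (tendsto_pow_atTop two_ne_zero)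

theorem tendsto_log_div_self : Tendsto (fun x : ℝ => Real.log x / x) atTop (𝓝 0) :=
  Real.isLittleO_log_id_atTop.tendsto_div_nhds_zero

/-- The exponential decay rate, on the scale `x ^ 2`, of the probability that a log-normal variable
is of the order `exp (-x / 2)`. -/
theorem exists_logNormal_real_Iic_le (m : ℝ) {s : ℝ} (hs : 0 < s) :
    ∃ g : ℝ → ℝ, (∀ᶠ x in atTop,
        (logNormal m s).real (Iic (x ^ 2 * Real.exp (-x / 2))) ≤ Real.exp (-g x)) ∧
      Tendsto (fun x => g x / x ^ 2) atTop (𝓝 ((s ^ 2)⁻¹ / 8)) := by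
  have hlim : Tendsto (fun x => m / x - 2 * (Real.log x / x) + 1 / 2) atTop (𝓝 (1 / 2)) := by
    simpa [-one_div] using ((tendsto_const_nhds (x := m).div_atTop tendsto_id).sub
      (tendsto_log_div_self.const_mul 2)).add_const (1 / 2)
  have heq : ∀ x : ℝ, 0 < x → (m - (2 * Real.log x - x / 2)) / x
      = m / x - 2 * (Real.log x / x) + 1 / 2 := fun x hx => by field
  refine ⟨fun x => (m - (2 * Real.log x - x / 2)) ^ 2 / (2 * s ^ 2), ?_, ?_⟩
  · filter_upwards [hlim.eventually (lt_mem_nhds (by norm_num : (0 : ℝ) < 1 / 2)),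
      eventually_gt_atTop 0] with x hx hx0
    rw [← heq x hx0, div_pos_iff_of_pos_right hx0] at hx
    have hlog : Real.log (x ^ 2 * Real.exp (-x / 2)) = 2 * Real.log x - x / 2 := by
      rw [Real.log_mul (by positivity) (Real.exp_pos _).ne', Real.log_exp, Real.log_pow]
      push_cast
      ring
    rw [logNormal_real_Iic m s (by positivity), hlog]
    have h := gaussianReal_real_Iic_le m (v := Real.toNNReal (s ^ 2)) (by simpa using hs.ne')
      (sub_pos.1 hx).le
    rwa [Real.coe_toNNReal _ (sq_nonneg s)] at h
  · have h := (hlim.pow 2).div_const (2 * s ^ 2)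
    rw [show (1 / 2 : ℝ) ^ 2 / (2 * s ^ 2) = (s ^ 2)⁻¹ / 8 by field] at h
    refine h.congr' ?_
    filter_upwards [eventually_gt_atTop 0] with x hx
    rw [← heq x hx]
    field

theorem le_logNormal_real_Ioc (m : ℝ) {s : ℝ} (hs : 0 < s) {p q a b R : ℝ} (hab : a ≤ b)
    (ha : p ≤ Real.exp a) (hb : Real.exp b ≤ q) (hR : ∀ t ∈ Ioc a b, |t - m| ≤ R) :
    (b - a) * ((√(2 * Real.pi * s ^ 2))⁻¹ * Real.exp (-(R ^ 2 / (2 * s ^ 2)))) ≤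
      (logNormal m s).real (Ioc p q) := by
  have h := le_gaussianReal_real_Ioc m (v := Real.toNNReal (s ^ 2)) (by simpa using hs.ne') hab hR
  rw [Real.coe_toNNReal _ (sq_nonneg s)] at h
  rw [logNormal, map_measureReal_apply Real.measurable_exp measurableSet_Ioc]
  exact h.trans (measureReal_mono fun y hy =>
    ⟨ha.trans_lt (Real.exp_lt_exp.2 hy.1), (Real.exp_le_exp.2 hy.2).trans hb⟩)

/-- A window of width `exp (-x / 2)` next to `0` costs a log-normal variable an exponent of order
`x ^ 2`, whereas a window of that width next to a positive number costs nothing on this scale. -/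
theorem exists_le_logNormal_real_Ioc (m : ℝ) {s p : ℝ} (hs : 0 < s) (hp : 0 ≤ p) :
    ∃ g : ℝ → ℝ, (∀ x, 0 < x →
        Real.exp (-g x) ≤ (logNormal m s).real (Ioc p (p + Real.exp (-x / 2)))) ∧
      Tendsto (fun x => g x / x ^ 2) atTop (𝓝 (if p = 0 then (s ^ 2)⁻¹ / 8 else 0)) := by
  set c := (√(2 * Real.pi * s ^ 2))⁻¹ with hc
  have hc0 : 0 < c := by positivity
  rcases hp.eq_or_lt with rfl | hp
  -- Only the part of the window with logarithm in `(-x / 2 - 1, -x / 2]` is used: it has unit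
  -- length and already carries the right exponent.
  · refine ⟨fun x => -Real.log c + (x / 2 + (1 + |m|)) ^ 2 / (2 * s ^ 2), fun x hx => ?_, ?_⟩
    · have h := le_logNormal_real_Ioc m hs (p := 0) (q := 0 + Real.exp (-x / 2)) (a := -x / 2 - 1)
        (b := -x / 2) (R := x / 2 + (1 + |m|)) (by linarith) (Real.exp_pos _).le (by simp)
        fun t ht => abs_le.2
          ⟨by linarith [ht.1, le_abs_self m], by linarith [ht.2, neg_abs_le m, abs_nonneg m]⟩
      refine le_trans (le_of_eq ?_) h
      rw [neg_add, neg_neg, Real.exp_add, Real.exp_log hc0]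
      ring
    · have hlim : Tendsto (fun x => 1 / 2 + (1 + |m|) / x) atTop (𝓝 (1 / 2)) := by
        simpa [-one_div] using
          (tendsto_const_nhds (x := 1 + |m|).div_atTop tendsto_id).const_add (1 / 2 : ℝ)
      have h := (tendsto_const_div_sq (-Real.log c)).add ((hlim.pow 2).div_const (2 * s ^ 2))
      rw [show 0 + (1 / 2 : ℝ) ^ 2 / (2 * s ^ 2) = (s ^ 2)⁻¹ / 8 by field] at h
      rw [if_pos rfl]
      refine h.congr' ?_
      filter_upwards [eventually_gt_atTop 0] with x hx
      field
  · set R := |Real.log p| + |Real.log (p + 1)| + |m|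
    set k := (p + 1)⁻¹ * (c * Real.exp (-(R ^ 2 / (2 * s ^ 2)))) with hk
    have hk0 : 0 < k := by positivity
    refine ⟨fun x => x / 2 - Real.log k, fun x hx => ?_, ?_⟩
    · have he0 := Real.exp_pos (-x / 2)
      have he1 : Real.exp (-x / 2) ≤ 1 := Real.exp_le_one_iff.2 (by linarith)
      have h := le_logNormal_real_Ioc m hs (p := p) (q := p + Real.exp (-x / 2)) (a := Real.log p)
        (b := Real.log (p + Real.exp (-x / 2))) (R := R)
        (Real.log_le_log hp (by linarith)) (Real.exp_log hp).ge
        (Real.exp_log (by positivity)).le fun t ht => by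
          have h1 : t ≤ Real.log (p + 1) :=
            ht.2.trans (Real.log_le_log (by positivity) (by linarith))
          have h2 := ht.1
          have h3 := abs_nonneg (Real.log p)
          have h4 := abs_nonneg (Real.log (p + 1))
          exact abs_le.2 ⟨by linarith [neg_abs_le (Real.log p), le_abs_self m],
            by linarith [le_abs_self (Real.log (p + 1)), neg_abs_le m]⟩
      refine le_trans ?_ h
      rw [neg_sub, sub_eq_add_neg, Real.exp_add, Real.exp_log hk0, hk, mul_right_comm, neg_div]
      refine mul_le_mul_of_nonneg_right ?_ (by positivity)
      -- On the logarithmic scale the window has length `log (1 + exp (-x / 2) / p)`, which by `1 -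
      -- 1 / y ≤ log y` is at least `exp (-x / 2) / (p + 1)`.
      have hl := Real.one_sub_inv_le_log_of_pos
        (show 0 < (p + Real.exp (-x / 2)) / p by positivity)
      rw [Real.log_div (by positivity) hp.ne'] at hl
      rw [← neg_div]
      refine le_trans ?_ hl
      rw [inv_div, one_sub_div (by positivity), add_sub_cancel_left, inv_mul_eq_div]
      gcongr
    · have h := (tendsto_const_nhds (x := (1 / 2 : ℝ)).div_atTop tendsto_id).sub
        (tendsto_const_div_sq (Real.log k))
      rw [sub_zero] at h
      rw [if_neg hp.ne']
      refine h.congr' ?_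
      filter_upwards [eventually_gt_atTop 0] with x hx
      simp only [id]
      field

/-! ### The diversity gain in the variable `x = ln ρ` -/

/-- With `ρ = exp x`, `ln (ρ / ln² ρ) = x - 2 ln x`, whose ratio to `x` tends to `1`. -/
theorem hasLargeScaleDiversityGain_iff {p : ℝ → ℝ} {D : ℝ} :
    HasLargeScaleDiversityGain p D ↔
      Tendsto (fun x : ℝ => 8 * (-Real.log (p (Real.exp x)) / x ^ 2)) atTop (𝓝 D) := by
  have hr : Tendsto (fun x : ℝ => (1 - 2 * (Real.log x / x)) ^ 2) atTop (𝓝 1) := by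
    simpa using ((tendsto_log_div_self.const_mul 2).const_sub 1).pow 2
  have hne : ∀ᶠ x : ℝ in atTop, (1 - 2 * (Real.log x / x)) ^ 2 ≠ 0 :=
    hr.eventually_ne one_ne_zero
  have heq : ∀ᶠ x : ℝ in atTop, -8 * Real.log (p (Real.exp x)) /
      Real.log (Real.exp x / Real.log (Real.exp x) ^ 2) ^ 2 =
      8 * (-Real.log (p (Real.exp x)) / x ^ 2) / (1 - 2 * (Real.log x / x)) ^ 2 := by
    filter_upwards [eventually_gt_atTop 0] with x hx
    have : Real.log (Real.exp x / Real.log (Real.exp x) ^ 2) = x * (1 - 2 * (Real.log x / x)) := by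
      rw [Real.log_exp, Real.log_div (Real.exp_pos _).ne' (by positivity), Real.log_exp,
        Real.log_pow]
      push_cast
      field
    rw [this, mul_pow, ← div_div]
    ring
  have h1 : HasLargeScaleDiversityGain p D ↔
      Tendsto (fun x : ℝ => 8 * (-Real.log (p (Real.exp x)) / x ^ 2) /
        (1 - 2 * (Real.log x / x)) ^ 2) atTop (𝓝 D) := by
    rw [← tendsto_congr' heq]
    refine ⟨fun h => h.comp Real.tendsto_exp_atTop,
      fun h => (h.comp Real.tendsto_log_atTop).congr' ?_⟩
    filter_upwards [eventually_gt_atTop 0] with ρ hρ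
    simp [Real.exp_log hρ]
  rw [h1]
  constructor <;> intro h
  · have := h.mul hr
    rw [mul_one] at this
    refine this.congr' ?_
    filter_upwards [hne] with x hx
    exact div_mul_cancel₀ _ hx
  · have := h.div hr one_ne_zero
    rwa [div_one] at this

/-! ### Bounds on the pairwise error probability -/

variable {M N : ℕ}

theorem measurable_distance (P ρ : ℝ) (e : Fin N → ℝ) :
    Measurable (distance (M := M) P ρ e) := by
  unfold distance dotProduct
  fun_prop

theorem integrable_gaussianQ_distance (m σ : Fin M → Fin N → ℝ) (P ρ : ℝ) (e : Fin N → ℝ) :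
    Integrable (fun h => gaussianQ (distance P ρ e h / 2)) (channelLaw m σ) := by
  refine Integrable.of_bound (C := 1) ?_ (ae_of_all _ fun h => ?_)
  · exact (gaussianQ_antitone.measurable.comp
      ((measurable_distance P ρ e).div_const 2)).aestronglyMeasurable
  · rw [Real.norm_of_nonneg (gaussianQ_pos _).le]
    exact gaussianQ_le_one _

theorem channelLaw_real_pi (m σ : Fin M → Fin N → ℝ) (S : Fin M → Fin N → Set ℝ) :
    (channelLaw m σ).real (univ.pi fun i => univ.pi (S i)) =
      ∏ i, ∏ j, (logNormal (m i j) (σ i j)).real (S i j) := by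
  simp [channelLaw, Measure.real, Measure.pi_pi, ENNReal.toReal_prod]

theorem ae_channelLaw_pos (m σ : Fin M → Fin N → ℝ) :
    ∀ᵐ h ∂channelLaw m σ, ∀ i j, 0 < h i j := by
  refine ae_all_iff.2 fun i => ?_
  have h1 : ∀ᵐ r ∂Measure.pi fun j => logNormal (m i j) (σ i j), ∀ j, 0 < r j :=
    ae_all_iff.2 fun j => Measure.tendsto_eval_ae_ae.eventually (ae_logNormal_pos (m i j) (σ i j))
  exact (Measure.tendsto_eval_ae_ae
    (μ := fun i => Measure.pi fun j => logNormal (m i j) (σ i j))).eventually h1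

theorem sq_distance {P ρ : ℝ} (hρ : 0 ≤ ρ) (e : Fin N → ℝ) (h : Fin M → Fin N → ℝ) :
    distance P ρ e h ^ 2 = ρ / ((N : ℝ) * P ^ 2) * ∑ i, (h i ⬝ᵥ e) ^ 2 :=
  Real.sq_sqrt (mul_nonneg (by positivity) (Finset.sum_nonneg fun _ _ => sq_nonneg _))

theorem neg_log_le_of_exp_neg_le {a b : ℝ} (h : Real.exp (-b) ≤ a) : -Real.log a ≤ b :=
  neg_le.1 ((Real.le_log_iff_exp_le ((Real.exp_pos _).trans_le h)).2 h)

/-- On the box of channels within `exp (-x / 2)` of `p`, orthogonality gives `(h i ⬝ᵥ e) ^ 2 = O(exp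
(-x))`. This cancels `ρ = exp x`, so the distance is bounded uniformly in `x`. -/
theorem mul_prod_le_pep (m σ : Fin M → Fin N → ℝ) (P : ℝ)
    (e : Fin N → ℝ) {p : Fin N → ℝ} (hpe : p ⬝ᵥ e = 0) :
    ∃ q : ℝ, 0 < q ∧ ∀ x : ℝ, q * ∏ i, ∏ j, (logNormal (m i j) (σ i j)).real
      (Ioc (p j) (p j + Real.exp (-x / 2))) ≤ pep m σ P e (Real.exp x) := by
  set E := ∑ j, |e j|
  set K := √(1 / ((N : ℝ) * P ^ 2) * (M * E ^ 2))
  refine ⟨gaussianQ (K / 2), gaussianQ_pos _, fun x => ?_⟩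
  rw [← channelLaw_real_pi]
  set S : Set (Fin M → Fin N → ℝ) :=
    univ.pi fun i => univ.pi fun j => Ioc (p j) (p j + Real.exp (-x / 2))
  have hS : MeasurableSet S :=
    MeasurableSet.univ_pi fun i => MeasurableSet.univ_pi fun j => measurableSet_Ioc
  have hd : ∀ h ∈ S, distance P (Real.exp x) e h ≤ K := by
    intro h hh
    have hrow : ∀ i, (h i ⬝ᵥ e) ^ 2 ≤ Real.exp (-x) * E ^ 2 := by
      intro i
      have h1 : |h i ⬝ᵥ e| ≤ Real.exp (-x / 2) * E := by
        have : h i ⬝ᵥ e = ∑ j, (h i j - p j) * e j := by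
          rw [← sub_zero (h i ⬝ᵥ e), ← hpe, ← sub_dotProduct]
          rfl
        rw [this, Finset.mul_sum]
        refine (Finset.abs_sum_le_sum_abs _ _).trans (Finset.sum_le_sum fun j _ => ?_)
        rw [abs_mul]
        have hj := hh i (mem_univ i) j (mem_univ j)
        gcongr
        rw [abs_of_pos (sub_pos.2 hj.1)]
        linarith [hj.2]
      rw [← sq_abs]
      refine (pow_le_pow_left₀ (abs_nonneg _) h1 2).trans_eq ?_
      rw [mul_pow, ← Real.exp_nat_mul]
      congr 2
      push_cast
      ring
    refine Real.sqrt_le_sqrt ?_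
    calc Real.exp x / ((N : ℝ) * P ^ 2) * ∑ i, (h i ⬝ᵥ e) ^ 2
        ≤ Real.exp x / ((N : ℝ) * P ^ 2) * ∑ _i : Fin M, Real.exp (-x) * E ^ 2 := by
          gcongr with i
          exact hrow i
      _ = Real.exp x * Real.exp (-x) / ((N : ℝ) * P ^ 2) * (M * E ^ 2) := by
          rw [Finset.sum_const, Finset.card_univ, Fintype.card_fin, nsmul_eq_mul]
          ring
      _ = _ := by rw [← Real.exp_add, add_neg_cancel, Real.exp_zero]
  have hint := integrable_gaussianQ_distance m σ P (Real.exp x) e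
  calc gaussianQ (K / 2) * (channelLaw m σ).real S
      = ∫ _ in S, gaussianQ (K / 2) ∂channelLaw m σ := by simp [mul_comm]
    _ ≤ ∫ h in S, gaussianQ (distance P (Real.exp x) e h / 2) ∂channelLaw m σ :=
        setIntegral_mono_on (integrableOn_const (by simp)) hint.integrableOn hS fun h hh =>
          gaussianQ_antitone (by linarith [hd h hh])
    _ ≤ pep m σ P e (Real.exp x) :=
        setIntegral_le_integral hint (ae_of_all _ fun h => (gaussianQ_pos _).le)

/-- If the nonnegative vector `p` is orthogonal to `e`, then channels with all rows close to `p`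
bound the decay of the pairwise error probability from above. -/
theorem exists_exp_neg_le_pep (m : Fin M → Fin N → ℝ) {σ : Fin M → Fin N → ℝ}
    (hσ : ∀ i j, 0 < σ i j) (P : ℝ) (e : Fin N → ℝ) {p : Fin N → ℝ}
    (hp : ∀ j, 0 ≤ p j) (hpe : p ⬝ᵥ e = 0) :
    ∃ G : ℝ → ℝ, (∀ x, 0 < x → Real.exp (-G x) ≤ pep m σ P e (Real.exp x)) ∧
      Tendsto (fun x => 8 * (G x / x ^ 2)) atTop
        (𝓝 (∑ i, ∑ j, if p j = 0 then (σ i j ^ 2)⁻¹ else 0)) := by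
  choose g hg hlim using fun i j => exists_le_logNormal_real_Ioc (m i j) (hσ i j) (hp j)
  obtain ⟨q, hq, hle⟩ := mul_prod_le_pep m σ P e hpe
  refine ⟨fun x => -Real.log q + ∑ i, ∑ j, g i j x, fun x hx => ?_, ?_⟩
  · refine le_trans ?_ (hle x)
    simp only [neg_add, neg_neg, Real.exp_add, Real.exp_log hq, ← Finset.sum_neg_distrib,
      Real.exp_sum]
    gcongr with i _ j
    exact hg i j x hx
  · have h := ((tendsto_const_div_sq (-Real.log q)).add (tendsto_finsetSum Finset.univ fun i _ =>
      tendsto_finsetSum Finset.univ fun j _ => hlim i j)).const_mul 8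
    convert h using 2 with x
    · simp only [add_div, Finset.sum_div]
    · simp only [zero_add, Finset.mul_sum]
      refine Finset.sum_congr rfl fun i _ => Finset.sum_congr rfl fun j _ => ?_
      split_ifs <;> ring

/-- Outside the box some `h i j` is large, and without cancellation `|h i ⬝ᵥ e| ≥ h i j * η`. The
factor `x ^ 2` in the threshold is invisible in the exponent of the box, yet makes the remainder
decay like `exp (-κ x ^ 4)`. -/
theorem pep_le (m σ : Fin M → Fin N → ℝ) (P : ℝ) {e : Fin N → ℝ}
    (he : IsUnipolar e) {η : ℝ} (hη : 0 ≤ η) (hle : ∀ j, η ≤ |e j|) (x : ℝ) :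
    pep m σ P e (Real.exp x) ≤
      (∏ i, ∏ j, (logNormal (m i j) (σ i j)).real (Iic (x ^ 2 * Real.exp (-x / 2)))) +
        Real.exp (-(η ^ 2 / (8 * (N * P ^ 2)) * x ^ 4)) := by
  rw [← channelLaw_real_pi]
  set S : Set (Fin M → Fin N → ℝ) :=
    univ.pi fun i => univ.pi fun j => Iic (x ^ 2 * Real.exp (-x / 2))
  have hS : MeasurableSet S :=
    MeasurableSet.univ_pi fun i => MeasurableSet.univ_pi fun j => measurableSet_Iic
  set B := Real.exp (-(η ^ 2 / (8 * (N * P ^ 2)) * x ^ 4))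
  have hpt : ∀ᵐ h ∂channelLaw m σ,
      gaussianQ (distance P (Real.exp x) e h / 2) ≤ S.indicator 1 h + B := by
    filter_upwards [ae_channelLaw_pos m σ] with h hpos
    by_cases hh : h ∈ S
    · rw [indicator_of_mem hh]
      exact (gaussianQ_le_one _).trans (le_add_of_nonneg_right (Real.exp_pos _).le)
    · rw [indicator_of_notMem hh, zero_add]
      simp only [S, Set.mem_pi, mem_univ, true_imp_iff, mem_Iic, not_forall, not_le] at hh
      obtain ⟨i, j, hij⟩ := hh
      have habs : |h i j * e j| ≤ |h i ⬝ᵥ e| := by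
        rcases he with he | he
        · have h0 : ∀ k, 0 ≤ h i k * e k := fun k => mul_nonneg (hpos i k).le (he k)
          rw [dotProduct, abs_of_nonneg (h0 j), abs_of_nonneg (Finset.sum_nonneg fun k _ => h0 k)]
          exact Finset.single_le_sum (fun k _ => h0 k) (Finset.mem_univ j)
        · have h0 : ∀ k, h i k * e k ≤ 0 := fun k =>
            mul_nonpos_of_nonneg_of_nonpos (hpos i k).le (he k)
          rw [dotProduct, abs_of_nonpos (h0 j), abs_of_nonpos (Finset.sum_nonpos fun k _ => h0 k),
            ← Finset.sum_neg_distrib]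
          exact Finset.single_le_sum (fun k _ => neg_nonneg.2 (h0 k)) (Finset.mem_univ j)
      have hsq : (x ^ 2 * Real.exp (-x / 2) * η) ^ 2 ≤ (h i ⬝ᵥ e) ^ 2 := by
        rw [← sq_abs (h i ⬝ᵥ e)]
        refine pow_le_pow_left₀ (by positivity) (le_trans ?_ habs) 2
        rw [abs_mul, abs_of_pos (hpos i j)]
        exact mul_le_mul hij.le (hle j) hη (hpos i j).le
      have hdist : 1 / (N * P ^ 2) * (x ^ 4 * η ^ 2) ≤ distance P (Real.exp x) e h ^ 2 := by
        rw [sq_distance (Real.exp_pos _).le]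
        calc 1 / ((N : ℝ) * P ^ 2) * (x ^ 4 * η ^ 2)
            = Real.exp x / ((N : ℝ) * P ^ 2) * (x ^ 2 * Real.exp (-x / 2) * η) ^ 2 := by
              have : Real.exp x * Real.exp (-x / 2) ^ 2 = 1 := by
                rw [← Real.exp_nat_mul, ← Real.exp_add, Real.exp_eq_one_iff]
                push_cast
                ring
              linear_combination (-(x ^ 4 * η ^ 2) / (N * P ^ 2)) * this
          _ ≤ _ := by
              gcongr
              exact hsq.trans (Finset.single_le_sum (f := fun i => (h i ⬝ᵥ e) ^ 2)
                (fun k _ => sq_nonneg _) (Finset.mem_univ i))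
      refine (gaussianQ_le (x := distance P (Real.exp x) e h / 2)
        (div_nonneg (Real.sqrt_nonneg _) zero_le_two)).trans
        (Real.exp_le_exp.2 (neg_le_neg ?_))
      calc η ^ 2 / (8 * (N * P ^ 2)) * x ^ 4 = 1 / (N * P ^ 2) * (x ^ 4 * η ^ 2) / 8 := by ring
        _ ≤ _ := by linarith
  have hint : Integrable (S.indicator (1 : (Fin M → Fin N → ℝ) → ℝ)) (channelLaw m σ) :=
    (integrable_const (1 : ℝ)).indicator hS
  refine (integral_mono_ae (integrable_gaussianQ_distance m σ P _ e)
    (hint.add (integrable_const B)) hpt).trans_eq ?_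
  simp only [Pi.add_apply]
  rw [integral_add hint (integrable_const B), integral_indicator_one hS]
  simp

/-! ### Full gain and its failure -/

theorem hasLargeScaleDiversityGain_fullGain (hN : 0 < N) (m : Fin M → Fin N → ℝ)
    {σ : Fin M → Fin N → ℝ} (hσ : ∀ i j, 0 < σ i j) {P : ℝ} (hP : P ≠ 0) {e : Fin N → ℝ}
    (he : IsUnipolar e) (hne : ∀ j, e j ≠ 0) :
    HasLargeScaleDiversityGain (pep m σ P e) (fullGain σ) := by
  rw [hasLargeScaleDiversityGain_iff]
  have : Nonempty (Fin N) := ⟨⟨0, hN⟩⟩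
  obtain ⟨j₀, hj₀⟩ := Finite.exists_min fun j => |e j|
  have hη : 0 < |e j₀| := abs_pos.2 (hne j₀)
  choose g hg hlim using fun i j => exists_logNormal_real_Iic_le (m i j) (hσ i j)
  obtain ⟨G, hG, hGlim⟩ := exists_exp_neg_le_pep m hσ P e (p := 0) (fun _ => le_rfl)
    (zero_dotProduct e)
  have hlow : Tendsto (fun x => (∑ i, ∑ j, g i j x) / x ^ 2) atTop (𝓝 (fullGain σ / 8)) := by
    have h := tendsto_finsetSum Finset.univ fun i (_ : i ∈ Finset.univ) =>
      tendsto_finsetSum Finset.univ fun j (_ : j ∈ Finset.univ) => hlim i j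
    simpa only [fullGain, Finset.sum_div] using h
  have hlow' := (hlow.sub (tendsto_const_div_sq (Real.log 2))).const_mul 8
  rw [sub_zero, mul_div_cancel₀ _ (by norm_num : (8 : ℝ) ≠ 0)] at hlow'
  refine tendsto_of_tendsto_of_tendsto_of_le_of_le' hlow' (by simpa [fullGain] using hGlim) ?_ ?_
  · set κ := |e j₀| ^ 2 / (8 * (N * P ^ 2))
    have hκ : 0 < κ := by positivity
    -- The box exponent is `O(x ^ 2)`, so the `x ^ 4` remainder is eventually at most the box term;
    -- the resulting factor `2` vanishes in the limit.
    have hdom : ∀ᶠ x : ℝ in atTop, (∑ i, ∑ j, g i j x) / x ^ 2 ≤ κ * x ^ 2 := by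
      filter_upwards [hlow.eventually_le_const (lt_add_one _),
        ((tendsto_pow_atTop (α := ℝ) two_ne_zero).const_mul_atTop hκ).eventually_ge_atTop
          (fullGain σ / 8 + 1)] with x h1 h2
      exact h1.trans h2
    filter_upwards [eventually_gt_atTop 0, hdom, eventually_all.2 fun i => eventually_all.2 (hg i)]
      with x hx hd hgx
    rw [div_le_iff₀ (by positivity)] at hd
    have hpep : pep m σ P e (Real.exp x) ≤ 2 * Real.exp (-∑ i, ∑ j, g i j x) := by
      refine (pep_le m σ P he hη.le hj₀ x).trans ?_
      rw [two_mul]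
      refine add_le_add ?_ (Real.exp_le_exp.2 (neg_le_neg (hd.trans_eq (by ring))))
      simp only [← Finset.sum_neg_distrib, Real.exp_sum]
      gcongr with i _ j
      exact hgx i j
    have hlog := Real.log_le_log ((Real.exp_pos _).trans_le (hG x hx)) hpep
    rw [Real.log_mul two_ne_zero (Real.exp_pos _).ne', Real.log_exp] at hlog
    rw [← sub_div]
    gcongr
    linarith
  · filter_upwards [eventually_gt_atTop 0] with x hx
    have := neg_log_le_of_exp_neg_le (hG x hx)
    gcongr

theorem not_hasLargeScaleDiversityGain_fullGain (hM : 0 < M) (m : Fin M → Fin N → ℝ)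
    {σ : Fin M → Fin N → ℝ} (hσ : ∀ i j, 0 < σ i j) (P : ℝ) {e p : Fin N → ℝ}
    (hp : ∀ j, 0 ≤ p j) (hpe : p ⬝ᵥ e = 0) (hp0 : p ≠ 0) :
    ¬ HasLargeScaleDiversityGain (pep m σ P e) (fullGain σ) := by
  rw [hasLargeScaleDiversityGain_iff]
  intro h
  obtain ⟨G, hG, hlim⟩ := exists_exp_neg_le_pep m hσ P e hp hpe
  obtain ⟨j₀, hj₀⟩ := Function.ne_iff.1 hp0
  -- The gain is at most the sum over entries with `p j = 0`, which misses the positive terms of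
  -- column `j₀`.
  refine absurd (le_of_tendsto_of_tendsto h hlim ?_) (not_le.2 ?_)
  · filter_upwards [eventually_gt_atTop 0] with x hx
    have := neg_log_le_of_exp_neg_le (hG x hx)
    gcongr
  · have hle : ∀ i j, (if p j = 0 then (σ i j ^ 2)⁻¹ else 0) ≤ (σ i j ^ 2)⁻¹ := fun i j => by
      have := hσ i j
      split_ifs
      exacts [le_rfl, by positivity]
    refine Finset.sum_lt_sum (fun i _ => Finset.sum_le_sum fun j _ => hle i j)
      ⟨⟨0, hM⟩, Finset.mem_univ _, Finset.sum_lt_sum (fun j _ => hle _ j)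
        ⟨j₀, Finset.mem_univ _, ?_⟩⟩
    rw [if_neg (by simpa using hj₀)]
    have := hσ ⟨0, hM⟩ j₀
    positivity

/-! ### Sign patterns of error vectors and the conclusion -/

theorem exists_nonneg_dotProduct_eq_zero {e : Fin N → ℝ}
    (h : ¬ (IsUnipolar e ∧ ∀ j, e j ≠ 0)) :
    ∃ p : Fin N → ℝ, (∀ j, 0 ≤ p j) ∧ p ⬝ᵥ e = 0 ∧ p ≠ 0 := by
  by_cases hz : ∃ j, e j = 0
  · obtain ⟨j, hj⟩ := hz
    refine ⟨Pi.single j 1, fun k => ?_, by simp [hj], by simp⟩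
    exact (Pi.single_nonneg (α := fun _ => ℝ)).2 zero_le_one k
  · have hu : ¬ IsUnipolar e := fun hu => h ⟨hu, fun j hj => hz ⟨j, hj⟩⟩
    simp only [IsUnipolar, not_or, not_forall, not_le] at hu
    obtain ⟨⟨b, hb⟩, a, ha⟩ := hu
    -- Since `e b < 0 < e a`, these positive weights balance the two entries.
    refine ⟨Pi.single a (-e b) + Pi.single b (e a), fun k => ?_, ?_, fun h0 => ?_⟩
    · exact add_nonneg ((Pi.single_nonneg (α := fun _ => ℝ)).2 (neg_pos.2 hb).le k)
        ((Pi.single_nonneg (α := fun _ => ℝ)).2 ha.le k)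
    · rw [add_dotProduct, single_dotProduct, single_dotProduct]
      ring
    · have hab : a ≠ b := by
        rintro rfl
        exact lt_asymm ha hb
      have := congrFun h0 b
      simp [hab.symm, ha.ne'] at this

theorem forall_vecMulVec_pos_iff {e : Fin N → ℝ} :
    (∀ i j, 0 < Matrix.vecMulVec e e i j) ↔ IsUnipolar e ∧ ∀ j, e j ≠ 0 := by
  simp only [Matrix.vecMulVec_apply]
  constructor
  · intro h
    refine ⟨?_, fun j hj => by simpa [hj] using h j j⟩
    by_contra hu
    simp only [IsUnipolar, not_or, not_forall, not_le] at hu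
    obtain ⟨⟨b, hb⟩, a, ha⟩ := hu
    exact (mul_neg_of_pos_of_neg ha hb).not_gt (h a b)
  · rintro ⟨hu | hu, h0⟩ i j
    · exact mul_pos ((hu i).lt_of_ne' (h0 i)) ((hu j).lt_of_ne' (h0 j))
    · exact mul_pos_of_neg_of_neg ((hu i).lt_of_ne (h0 i)) ((hu j).lt_of_ne (h0 j))

theorem enablesFullLargeScaleDiversity_iff {L : ℕ} (hM : 0 < M) (m : Fin M → Fin N → ℝ)
    {σ : Fin M → Fin N → ℝ} (hσ : ∀ i j, 0 < σ i j) (C : SpaceCode L N)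
    (hP : 0 < C.opticalPower) :
    EnablesFullLargeScaleDiversity m σ C ↔
      ∀ e ∈ C.errorSet, IsUnipolar e ∧ ∀ j, e j ≠ 0 := by
  -- Without transmitters the optical power would be an empty sum.
  have hN : 0 < N := by
    rcases N.eq_zero_or_pos with rfl | hN
    · simp [SpaceCode.opticalPower] at hP
    · exact hN
  refine forall₂_congr fun e _ => ⟨fun h => ?_, fun h =>
    hasLargeScaleDiversityGain_fullGain hN m hσ hP.ne' h.1 h.2⟩
  by_contra hb
  obtain ⟨p, hp, hpe, hp0⟩ := exists_nonneg_dotProduct_eq_zero hb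
  exact not_hasLargeScaleDiversityGain_fullGain hM m hσ _ hp hpe hp0 h

end MimoOwc

theorem theorem2 {M N L : ℕ} (hM : 0 < M) (m σ : Fin M → Fin N → ℝ) (hσ : ∀ i j, 0 < σ i j)
    (C : MimoOwc.SpaceCode L N) (hP : 0 < C.opticalPower) :
    (MimoOwc.EnablesFullLargeScaleDiversity m σ C ↔
      ∀ e ∈ C.errorSet, MimoOwc.IsUnipolar e ∧ ∀ j, e j ≠ 0) ∧
    (MimoOwc.EnablesFullLargeScaleDiversity m σ C ↔
      ∀ e ∈ C.errorSet, ∀ i j, 0 < Matrix.vecMulVec e e i j) := by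
  have h := MimoOwc.enablesFullLargeScaleDiversity_iff hM m hσ C hP
  exact ⟨h, h.trans (forall₂_congr fun _ _ => MimoOwc.forall_vecMulVec_pos_iff.symm)⟩
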